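/- Let $F$ be a field of characteristic $0$ with algebraic closure $\bar F$, and let $T=(a_{ijk})_{1\le i,j,k\le 4}$ be a $4\times4\times4$ matrix with entries in $F$, viewed as a trilinear form $T(x,y,z)=\sum a_{ijk}x_iy_jz_k$. Let $X_1,X_2,X_3\subset\mathbb P^3_F$ be the vanishing loci of the forms $\det T(x,\cdot,\cdot)$, $\det T(\cdot,y,\cdot)$ and $\det T(\cdot,\cdot,z)$ respectively, and suppose that each of these three surfaces has only isolated double point singularities (over $\bar F$: finitely many singular points of the defining form, each of multiplicity $2$). Let $\psi_{12}:X_1\dashrightarrow X_2$ be the birational map sending $x$ to the point $y$ with $T(x,y,\cdot)=0$, defined where the kernel of $T(x,\cdot,\cdot)$ is one-dimensional; let $\psi_{23}:X_2\dashrightarrow X_3$ (with $T(\cdot,y,z)=0$) and $\psi_{31}:X_3\dashrightarrow X_1$ (with $T(x,\cdot,z)=0$) be defined in the same way. Let $\tilde X_i\to X_i$ be nonsingular models (schemes smooth over $F$ with a proper birational morphism to $X_i$) such that $\psi_{12},\psi_{23},\psi_{31}$ lift to isomorphisms $\tilde\psi_{12}:\tilde X_1\to\tilde X_2$, $\tilde\psi_{23}:\tilde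 X_2\to\tilde X_3$, $\tilde\psi_{31}:\tilde X_3\to\tilde X_1$ over $F$, and let $\tilde\Phi=\tilde\psi_{31}\circ\tilde\psi_{23}\circ\tilde\psi_{12}$ be the resulting automorphism of $\tilde X_1$. A hyperdeterminant of $4\times4\times4$ matrices is a polynomial of minimal degree in the $64$ entries, with coefficients in $F$, which vanishes at a $4\times 4\times 4$ matrix $A$ over $\bar F$ if and only if $A$ has a nontrivial kernel, i.e. there are nonzero $x,y,z\in\bar F^4$ with $A(x,y,\cdot)=0$, $A(x,\cdot,z)=0$ and $A(\cdot,y,z)=0$. If $\tilde\Phi$ has a fixed point (an $\bar F$-point of $\tilde X_1$), then the hyperdeterminant of $T$ vanishes. Consequently, if the hyperdeterminant of $T$ is nonzero, then $\tilde\Phi$ has no fixed points. -/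

import Mathlib

open AlgebraicGeometry CategoryTheory

universe u

noncomputable section

namespace RubiksRevenge

attribute [local instance] MvPolynomial.gradedAlgebra

/-! ### `4 × 4 × 4` matrices, kernels, hyperdeterminants -/

/-- A `4 × 4 × 4` matrix `(a_{ijk})` with entries in `R`. -/
abbrev Cube (R : Type u) : Type u := Fin 4 → Fin 4 → Fin 4 → R

/-- The trilinear form `A(x, y, z) = ∑ a_{ijk} x_i y_j z_k`. -/
def Cube.form {K : Type u} [Field K] (A : Cube K) (x y z : Fin 4 → K) : K :=
  ∑ i, ∑ j, ∑ k, A i j k * x i * y j * z k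

/-- The same `4 × 4 × 4` matrix, with its entries viewed in the algebraic closure. -/
def Cube.geom {F : Type u} [Field F] (A : Cube F) : Cube (AlgebraicClosure F) :=
  fun i j k => algebraMap F (AlgebraicClosure F) (A i j k)

/-- `A` has a nontrivial kernel: there is a nonzero pure tensor `x ⊗ y ⊗ z` such that
`A(x, y, ·) = 0`, `A(x, ·, z) = 0` and `A(·, y, z) = 0`. -/
def Cube.HasNontrivialKernel {K : Type u} [Field K] (A : Cube K) : Prop :=
  ∃ x y z : Fin 4 → K, x ≠ 0 ∧ y ≠ 0 ∧ z ≠ 0 ∧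
    (∀ w, A.form x y w = 0) ∧ (∀ w, A.form x w z = 0) ∧ (∀ w, A.form w y z = 0)

/-- The value of a polynomial in the `64` entries of a `4 × 4 × 4` matrix, where the coefficients
of the polynomial lie in `F` and the entries of the matrix in an `F`-algebra. -/
def evalCube {F K : Type u} [Field F] [Field K] [Algebra F K]
    (D : MvPolynomial (Fin 4 × Fin 4 × Fin 4) F) (A : Cube K) : K :=
  MvPolynomial.aeval (fun m => A m.1 m.2.1 m.2.2) D

/-- The vanishing of the polynomial `D` is equivalent to having a nontrivial kernel, for all
`4 × 4 × 4` matrices over the algebraic closure. -/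
def DetectsKernel {F : Type u} [Field F] (D : MvPolynomial (Fin 4 × Fin 4 × Fin 4) F) : Prop :=
  ∀ A : Cube (AlgebraicClosure F), evalCube D A = 0 ↔ A.HasNontrivialKernel

/-- `D` is a hyperdeterminant: a polynomial of minimal degree in the entries of a `4 × 4 × 4`
matrix whose vanishing is equivalent to the matrix having a nontrivial kernel. -/
def IsHyperdeterminant {F : Type u} [Field F]
    (D : MvPolynomial (Fin 4 × Fin 4 × Fin 4) F) : Prop :=
  DetectsKernel D ∧ ∀ D' : MvPolynomial (Fin 4 × Fin 4 × Fin 4) F,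
    DetectsKernel D' → D.totalDegree ≤ D'.totalDegree

/-! ### The three quartic forms and their singularities -/

/-- The quartic form `det A(x, ·, ·)` in `x`. -/
def Cube.quartic₁ {F : Type u} [Field F] (A : Cube F) : MvPolynomial (Fin 4) F :=
  (Matrix.of fun j k => ∑ i, MvPolynomial.C (A i j k) * MvPolynomial.X i).det

/-- The quartic form `det A(·, y, ·)` in `y`. -/
def Cube.quartic₂ {F : Type u} [Field F] (A : Cube F) : MvPolynomial (Fin 4) F :=
  (Matrix.of fun i k => ∑ j, MvPolynomial.C (A i j k) * MvPolynomial.X j).det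

/-- The quartic form `det A(·, ·, z)` in `z`. -/
def Cube.quartic₃ {F : Type u} [Field F] (A : Cube F) : MvPolynomial (Fin 4) F :=
  (Matrix.of fun i j => ∑ k, MvPolynomial.C (A i j k) * MvPolynomial.X k).det

/-- The geometric point of `ℙ³` with homogeneous coordinates `x` is a singular point of the
surface `f = 0`. -/
def IsSingularAt {F : Type u} [Field F] (f : MvPolynomial (Fin 4) F)
    (x : Fin 4 → AlgebraicClosure F) : Prop :=
  MvPolynomial.aeval x f = 0 ∧ ∀ i, MvPolynomial.aeval x (MvPolynomial.pderiv i f) = 0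

/-- The surface `f = 0` in `ℙ³` has only isolated double point singularities: over the algebraic
closure it has finitely many singular points, and each of them has multiplicity two, that is,
some second order partial derivative of `f` does not vanish there. -/
def OnlyIsolatedDoublePoints {F : Type u} [Field F] (f : MvPolynomial (Fin 4) F) : Prop :=
  {p : Projectivization (AlgebraicClosure F) (Fin 4 → AlgebraicClosure F) |
      IsSingularAt f p.rep}.Finite ∧
    ∀ x : Fin 4 → AlgebraicClosure F, x ≠ 0 → IsSingularAt f x →
      ∃ i j, MvPolynomial.aeval x (MvPolynomial.pderiv i (MvPolynomial.pderiv j f)) ≠ 0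

/-! ### Projective space and quartic surfaces as schemes -/

/-- Projective three-space over `F`. -/
abbrev P3 (F : Type u) [Field F] : Scheme.{u} :=
  Proj (MvPolynomial.homogeneousSubmodule (Fin 4) F)

/-- The structure morphism of `ℙ³`. -/
def P3.toSpec (F : Type u) [Field F] : P3 F ⟶ Spec (.of F) :=
  Proj.toSpecZero (MvPolynomial.homogeneousSubmodule (Fin 4) F) ≫
    Spec.map (CommRingCat.ofHom
      (algebraMap F (MvPolynomial.homogeneousSubmodule (Fin 4) F 0)))

/-- Evaluation of polynomials at `v ∈ K⁴`, with values in the global functions on `Spec K`. -/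
def evalAt {F K : Type u} [Field F] [Field K] [Algebra F K] (v : Fin 4 → K) :
    MvPolynomial (Fin 4) F →+* Γ(Spec (.of K), ⊤) :=
  (Scheme.ΓSpecIso (.of K)).inv.hom.comp (MvPolynomial.aeval (R := F) v).toRingHom

lemma map_irrelevant_evalAt {F K : Type u} [Field F] [Field K] [Algebra F K] {v : Fin 4 → K}
    (hv : v ≠ 0) :
    (HomogeneousIdeal.irrelevant (MvPolynomial.homogeneousSubmodule (Fin 4) F)).toIdeal.map
      (evalAt (F := F) v) = ⊤ := by
  obtain ⟨i, hi⟩ := Function.ne_iff.mp hv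
  refine Ideal.eq_top_of_isUnit_mem _ (x := evalAt (F := F) v (MvPolynomial.X i))
    (Ideal.mem_map_of_mem _ ?_) ?_
  · change _ ∈ HomogeneousIdeal.irrelevant _
    rw [HomogeneousIdeal.mem_irrelevant_iff, GradedRing.proj_apply,
      DirectSum.decompose_of_mem_ne (MvPolynomial.homogeneousSubmodule (Fin 4) F) (i := 1)
        (MvPolynomial.isHomogeneous_X F i) one_ne_zero]
  · have h : IsUnit (MvPolynomial.aeval (R := F) v (MvPolynomial.X i)) := by
      rw [MvPolynomial.aeval_X]
      exact isUnit_iff_ne_zero.mpr hi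
    exact h.map (Scheme.ΓSpecIso (.of K)).inv.hom

/-- The `K`-point `[v₀ : v₁ : v₂ : v₃]` of `ℙ³`. -/
def P3.point {F K : Type u} [Field F] [Field K] [Algebra F K] (v : Fin 4 → K) (hv : v ≠ 0) :
    Spec (.of K) ⟶ P3 F :=
  Proj.fromOfGlobalSections _ (evalAt (F := F) v) (map_irrelevant_evalAt hv)

/-- The vanishing locus of `f` in `ℙ³`, as a closed subset. -/
def vanishingLocus {F : Type u} [Field F] (f : MvPolynomial (Fin 4) F) :
    TopologicalSpace.Closeds (P3 F) :=
  ⟨ProjectiveSpectrum.zeroLocus (MvPolynomial.homogeneousSubmodule (Fin 4) F) {f},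
    ProjectiveSpectrum.isClosed_zeroLocus _ _⟩

/-- The vanishing locus of `f` in `ℙ³`, with its structure of reduced closed subscheme. (If the
surface `f = 0` has only isolated singularities, `f` is squarefree and this is the same as the
closed subscheme with equation `f`.) -/
def surface {F : Type u} [Field F] (f : MvPolynomial (Fin 4) F) : Scheme.{u} :=
  (Scheme.IdealSheafData.vanishingIdeal (vanishingLocus f)).subscheme

/-- The inclusion of the surface `f = 0` in `ℙ³`. -/
def surfaceι {F : Type u} [Field F] (f : MvPolynomial (Fin 4) F) : surface f ⟶ P3 F :=
  (Scheme.IdealSheafData.vanishingIdeal (vanishingLocus f)).subschemeι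

/-- A nonsingular model of the surface `f = 0`: a scheme smooth over `F`, with a proper birational
morphism `π` to the surface. -/
structure NonsingularModel {F : Type u} [Field F] (f : MvPolynomial (Fin 4) F) where
  /-- the nonsingular surface -/
  scheme : Scheme.{u}
  /-- the resolution morphism -/
  π : scheme ⟶ surface f
  proper : IsProper π
  smooth : Smooth (π ≫ surfaceι f ≫ P3.toSpec F)
  birational : ∃ U : (surface f).Opens, Dense (U : Set (surface f)) ∧
    Dense ((π ⁻¹ᵁ U : scheme.Opens) : Set scheme) ∧ IsIso (π ∣_ U)

section

variable {F : Type u} [Field F] {f g : MvPolynomial (Fin 4) F}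

/-- The structure morphism of a nonsingular model. -/
def NonsingularModel.toSpec (M : NonsingularModel f) : M.scheme ⟶ Spec (.of F) :=
  M.π ≫ surfaceι f ≫ P3.toSpec F

/-- A morphism from the spectrum of the algebraic closure is a geometric point, that is,
a morphism over `F`. -/
def NonsingularModel.IsGeometricPoint (M : NonsingularModel f)
    (p : Spec (.of (AlgebraicClosure F)) ⟶ M.scheme) : Prop :=
  p ≫ M.toSpec = Spec.map (CommRingCat.ofHom (algebraMap F (AlgebraicClosure F)))

/-- The image in `ℙ³` of the geometric point `p` of the nonsingular model is the point with
homogeneous coordinates `v`. -/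
def NonsingularModel.LiesOver (M : NonsingularModel f)
    (p : Spec (.of (AlgebraicClosure F)) ⟶ M.scheme) (v : Fin 4 → AlgebraicClosure F) : Prop :=
  ∃ hv : v ≠ 0, p ≫ M.π ≫ surfaceι f = P3.point v hv

/-- Some geometric point of the nonsingular model is fixed by the automorphism `Φ`. -/
def NonsingularModel.HasFixedPoint (M : NonsingularModel f) (Φ : M.scheme ≅ M.scheme) : Prop :=
  ∃ p : Spec (.of (AlgebraicClosure F)) ⟶ M.scheme, M.IsGeometricPoint p ∧ p ≫ Φ.hom = p

/-! ### The birational maps between the surfaces and their lifts -/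

/-- For a trilinear form `B` on `K⁴ × K⁴ × K⁴`, the relation `ψ(x) = y` of the partially defined
map sending `[x]` to `[y]` when the kernel `{y' : B(x, y', ·) = 0}` is the line spanned by `y`. -/
def KernelMap {K : Type u} [Field K] (B : (Fin 4 → K) → (Fin 4 → K) → (Fin 4 → K) → K)
    (x y : Fin 4 → K) : Prop :=
  y ≠ 0 ∧ ∀ y', (∀ z, B x y' z = 0) ↔ ∃ c : K, y' = c • y

/-- `ψ₁₂ : X₁ ⇢ X₂`, sending `x` to the kernel of `A(x, ·, ·)` in the second factor. -/
def Cube.psi₁₂ (A : Cube F) (x y : Fin 4 → AlgebraicClosure F) : Prop :=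
  KernelMap (fun x y z => A.geom.form x y z) x y

/-- `ψ₂₃ : X₂ ⇢ X₃`, sending `y` to the kernel of `A(·, y, ·)` in the third factor. -/
def Cube.psi₂₃ (A : Cube F) (y z : Fin 4 → AlgebraicClosure F) : Prop :=
  KernelMap (fun y z x => A.geom.form x y z) y z

/-- `ψ₃₁ : X₃ ⇢ X₁`, sending `z` to the kernel of `A(·, ·, z)` in the first factor. -/
def Cube.psi₃₁ (A : Cube F) (z x : Fin 4 → AlgebraicClosure F) : Prop :=
  KernelMap (fun z x y => A.geom.form x y z) z x

/-- The isomorphism `Ψ` of nonsingular models is a lift of the birational map `ψ` between the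
surfaces (given by its graph, in homogeneous coordinates, on geometric points): it is an
isomorphism over `F`, and maps every point over a point `[x]` at which `ψ` is defined, with
`ψ [x] = [y]`, to a point over `[y]`. Such a lift is unique if it exists. -/
structure IsLift (ψ : (Fin 4 → AlgebraicClosure F) → (Fin 4 → AlgebraicClosure F) → Prop)
    (M : NonsingularModel f) (N : NonsingularModel g) (Ψ : M.scheme ≅ N.scheme) : Prop where
  isOver : Ψ.hom ≫ N.toSpec = M.toSpec
  lift : ∀ p : Spec (.of (AlgebraicClosure F)) ⟶ M.scheme, M.IsGeometricPoint p →
    ∀ x y, M.LiesOver p x → ψ x y → N.LiesOver (p ≫ Ψ.hom) y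

end

end RubiksRevenge

end

open RubiksRevenge

/-! A geometric point `p` fixed by the composite, together with its images under `Ψ₁₂` and `Ψ₂₃ ∘
Ψ₁₂`, lies over points `x`, `y`, `z` of `ℙ³`. If `T(x, y, ·)`, `T(·, y, z)` and `T(x, ·, z)` all
vanish, then `x ⊗ y ⊗ z` is a nontrivial kernel and the hyperdeterminant is zero. Where the maps `ψ`
are defined, these equations are their definition; the difficulty is that `p` or its images may lie
over points where they are not.

The remedy is continuity, `IsLift.form_eq_zero`: the equation `T(x, y, ·) = 0` is a closed condition
on the nonsingular model, so it suffices that every nonempty open subset of the model contains a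
geometric point over a point where `ψ₁₂` is defined.

Two facts give this density. Where the matrix of linear forms has corank at least two, its
determinant lies in the square of the maximal ideal, so the quartic is singular there
(`isSingularAt_of_independent`); hence `ψ₁₂` is defined away from finitely many points. A nonempty
open part of a surface in `ℙ³` is never contained in a finite set of points
(`exists_zero_avoiding_finite`), and this passes to the model because it is birational to the
surface.

Cyclic rotation of the three factors of `T` reduces `ψ₂₃` and `ψ₃₁` to `ψ₁₂`. -/

noncomputable section

namespace RubiksRevenge

attribute [local instance] MvPolynomial.gradedAlgebra


/-! ### Determinants of matrices with two kernel vectors modulo an ideal -/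

section Determinant

variable {R : Type*} [CommRing R] {n : Type*} [Fintype n] [DecidableEq n]

/-- Every term of the Leibniz expansion contains one factor from column `a` and another from column
`b`. -/
lemma det_mem_sq_of_two_columns (I : Ideal R) (A : Matrix n n R) {a b : n} (hab : a ≠ b)
    (ha : ∀ j, A j a ∈ I) (hb : ∀ j, A j b ∈ I) : A.det ∈ I ^ 2 := by
  rw [Matrix.det_apply']
  refine Ideal.sum_mem _ fun σ _ => Ideal.mul_mem_left _ _ ?_
  rw [← Finset.mul_prod_erase _ _ (Finset.mem_univ a),
    ← Finset.mul_prod_erase _ _ (Finset.mem_erase.mpr ⟨hab.symm, Finset.mem_univ b⟩), ← mul_assoc,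
    pow_two]
  exact Ideal.mul_mem_right _ _ (Ideal.mul_mem_mul (ha _) (hb _))

lemma det_updateCol_mulVec (A : Matrix n n R) (j : n) (c : n → R) :
    (A.updateCol j (A.mulVec c)).det = c j * A.det := by
  rw [← smul_eq_mul, ← Matrix.det_updateCol_sum A j c]
  congr 2
  ext k
  simp [Matrix.mulVec, dotProduct, mul_comm]

/-- If two independent vectors are killed by `A` modulo `I`, then `det A` lies in `I ^ 2`, up to a
factor which is a minor of the two vectors. -/
lemma mul_det_mem_sq (I : Ideal R) (A : Matrix n n R) {a b : n} (hab : a ≠ b) (c d : n → R)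
    (hd : d a = 0) (hAc : ∀ j, A.mulVec c j ∈ I) (hAd : ∀ j, A.mulVec d j ∈ I) :
    d b * (c a * A.det) ∈ I ^ 2 := by
  -- Since `d a = 0`, the product with `d` does not see column `a`. So both columns can be replaced
  -- in turn, at the cost of the factors `c a` and `d b`.
  have h : (A.updateCol a (A.mulVec c)).mulVec d = A.mulVec d := by
    ext j
    refine Finset.sum_congr rfl fun k _ => ?_
    by_cases hk : k = a
    · subst hk; simp [hd]
    · simp [Matrix.updateCol_ne hk]
  rw [← det_updateCol_mulVec, ← det_updateCol_mulVec _ b, h]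
  refine det_mem_sq_of_two_columns I _ hab (fun j => ?_) fun j => ?_
  · rw [Matrix.updateCol_ne hab, Matrix.updateCol_self]; exact hAc j
  · rw [Matrix.updateCol_self]; exact hAd j

lemma derivation_mem_of_mem_sq {k : Type*} [CommRing k] [Algebra k R] (D : Derivation k R R)
    {I : Ideal R} {r : R} (hr : r ∈ I ^ 2) : D r ∈ I := by
  rw [pow_two] at hr
  refine Submodule.mul_induction_on hr (fun x hx y hy => ?_) fun x y hx hy => ?_
  · rw [D.leibniz]
    exact I.add_mem (I.mul_mem_right _ hx) (I.mul_mem_right _ hy)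
  · rw [map_add]; exact I.add_mem hx hy

end Determinant

/-! ### Corank of the matrix of linear forms and singularities of the quartic -/

section Quartic

variable {F : Type u} [Field F]

lemma aeval_quartic₁ {K : Type*} [CommRing K] [Algebra F K] (B : Cube F) (v : Fin 4 → K) :
    MvPolynomial.aeval v B.quartic₁ =
      (Matrix.of fun j k => ∑ i, algebraMap F K (B i j k) * v i).det := by
  rw [Cube.quartic₁, AlgHom.map_det]
  congr 1
  ext j k
  simp

lemma quartic₁_isHomogeneous (B : Cube F) : B.quartic₁.IsHomogeneous 4 := by
  rw [Cube.quartic₁, Matrix.det_apply']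
  refine MvPolynomial.IsHomogeneous.sum _ _ _ fun σ _ => ?_
  have h := MvPolynomial.IsHomogeneous.prod (R := F) Finset.univ
    (fun i : Fin 4 => Matrix.of (fun j k => ∑ i, MvPolynomial.C (B i j k) * MvPolynomial.X i)
      (σ i) i) (fun _ => 1) fun i _ => by
        rw [Matrix.of_apply]
        exact MvPolynomial.IsHomogeneous.sum _ _ _ fun j _ =>
          MvPolynomial.isHomogeneous_C_mul_X _ j
  have h' := (MvPolynomial.isHomogeneous_C (Fin 4) ((Equiv.Perm.sign σ : ℤ) : F)).mul h
  simpa using h'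

/-- A point where the matrix of linear forms has corank at least two is a singular point of its
determinant. -/
lemma isSingularAt_of_independent (B : Cube F) (v y y' : Fin 4 → AlgebraicClosure F)
    (hy : y ≠ 0) (h : ∀ z, B.geom.form v y z = 0) (h' : ∀ z, B.geom.form v y' z = 0)
    (hyy' : ∀ c : AlgebraicClosure F, y' ≠ c • y) : IsSingularAt B.quartic₁ v := by
  obtain ⟨a, ha⟩ := Function.ne_iff.mp hy
  simp only [Pi.zero_apply] at ha
  -- Subtracting a multiple of `y` arranges `d a = 0`, as `mul_det_mem_sq` requires; `d` is nonzero
  -- by independence.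
  set d := y' - (y' a / y a) • y with hd
  have hd0 : d ≠ 0 := sub_ne_zero.mpr (hyy' _)
  have hda : d a = 0 := by simp [hd, ha]
  obtain ⟨b, hb⟩ := Function.ne_iff.mp hd0
  simp only [Pi.zero_apply] at hb
  have hab : a ≠ b := by rintro rfl; exact hb hda
  let K := AlgebraicClosure F
  let I : Ideal (MvPolynomial (Fin 4) K) := RingHom.ker (MvPolynomial.eval v)
  let A : Matrix (Fin 4) (Fin 4) (MvPolynomial (Fin 4) K) :=
    Matrix.of fun k j => ∑ i, MvPolynomial.C (B.geom i j k) * MvPolynomial.X i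
  have hdet : A.det = MvPolynomial.map (algebraMap F K) B.quartic₁ := by
    rw [Cube.quartic₁, ← Matrix.det_transpose, RingHom.map_det]
    congr 1
    ext1 j k
    simp [A, Cube.geom, K]
  have key (w : Fin 4 → K) (hw : ∀ z, B.geom.form v w z = 0) (k) :
      A.mulVec (fun i => MvPolynomial.C (w i)) k ∈ I := by
    have := hw (Pi.single k 1)
    simp only [Cube.form] at this
    simp only [I, RingHom.mem_ker, A, Matrix.mulVec, dotProduct, Matrix.of_apply, map_sum, map_mul,
      MvPolynomial.eval_C, MvPolynomial.eval_X]
    rw [← this, Finset.sum_comm]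
    refine Finset.sum_congr rfl fun j _ => ?_
    rw [Finset.sum_mul]
    refine Finset.sum_congr rfl fun i _ => ?_
    simp [Pi.single_apply]
  have hd' (z) : B.geom.form v d z = 0 := by
    have : B.geom.form v d z = B.geom.form v y' z - (y' a / y a) * B.geom.form v y z := by
      simp only [Cube.form, Finset.mul_sum, ← Finset.sum_sub_distrib, hd, Pi.sub_apply,
        Pi.smul_apply, smul_eq_mul]
      exact Finset.sum_congr rfl fun i _ => Finset.sum_congr rfl fun i _ =>
        Finset.sum_congr rfl fun i _ => by ring
    rw [this, h, h']; ring
  have hmem := mul_det_mem_sq I A hab (fun i => MvPolynomial.C (y i))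
    (fun i => MvPolynomial.C (d i)) (by simp [hda]) (key y h) (key d hd')
  rw [← mul_assoc, ← map_mul] at hmem
  -- The minor `d b * y a` is a nonzero constant, hence a unit.
  have hmem' : A.det ∈ I ^ 2 := by
    have := Ideal.mul_mem_left _ (MvPolynomial.C (d b * y a)⁻¹) hmem
    rwa [← mul_assoc, ← map_mul, inv_mul_cancel₀ (mul_ne_zero hb ha), map_one, one_mul] at this
  rw [hdet] at hmem'
  refine ⟨?_, fun i => ?_⟩
  · have := Ideal.pow_le_self two_ne_zero hmem'
    rwa [RingHom.mem_ker, MvPolynomial.eval_map, ← MvPolynomial.aeval_def] at this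
  · have := derivation_mem_of_mem_sq (MvPolynomial.pderiv i) hmem'
    rwa [MvPolynomial.pderiv_map, RingHom.mem_ker, MvPolynomial.eval_map,
      ← MvPolynomial.aeval_def] at this

lemma exists_form_eq_zero (B : Cube F) (v : Fin 4 → AlgebraicClosure F)
    (hv : MvPolynomial.aeval v B.quartic₁ = 0) :
    ∃ y ≠ 0, ∀ z, B.geom.form v y z = 0 := by
  rw [aeval_quartic₁, ← Matrix.det_transpose, ← Matrix.exists_mulVec_eq_zero_iff] at hv
  obtain ⟨y, hy, h⟩ := hv
  refine ⟨y, hy, fun z => ?_⟩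
  have : B.geom.form v y z = ∑ k, (∑ j, (∑ i, algebraMap F _ (B i j k) * v i) * y j) * z k := by
    simp only [Cube.form, Cube.geom, Finset.sum_mul]
    rw [Finset.sum_comm]
    refine (Finset.sum_congr rfl fun j _ => Finset.sum_comm).trans ?_
    rw [Finset.sum_comm]
  rw [this]
  refine Finset.sum_eq_zero fun k _ => ?_
  have := congrFun h k
  simp only [Matrix.mulVec, dotProduct, Matrix.transpose_apply, Matrix.of_apply,
    Pi.zero_apply] at this
  rw [this, zero_mul]

lemma form_smul_left {K : Type u} [Field K] (A : Cube K) (c : K) (x y z : Fin 4 → K) :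
    A.form (c • x) y z = c * A.form x y z := by
  simp only [Cube.form, Finset.mul_sum, Pi.smul_apply, smul_eq_mul]
  exact Finset.sum_congr rfl fun i _ => Finset.sum_congr rfl fun i _ =>
        Finset.sum_congr rfl fun i _ => by ring

/-- `ψ₁₂` is defined at every point of the surface whose chosen representative is nonsingular. -/
lemma exists_psi₁₂ (B : Cube F) (v : Fin 4 → AlgebraicClosure F) (hv0 : v ≠ 0)
    (hv : MvPolynomial.aeval v B.quartic₁ = 0)
    (hs : ¬ IsSingularAt B.quartic₁ (Projectivization.mk (AlgebraicClosure F) v hv0).rep) :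
    ∃ y, B.psi₁₂ v y := by
  obtain ⟨y, hy, h⟩ := exists_form_eq_zero B v hv
  obtain ⟨c, hc⟩ := Projectivization.exists_smul_eq_mk_rep (AlgebraicClosure F) v hv0
  refine ⟨y, hy, fun y' => ⟨fun h' => ?_, ?_⟩⟩
  -- The singular set is described by chosen representatives, so the two kernel vectors are moved
  -- from `v` to its rescaling.
  · by_contra! hyy'
    refine hs (isSingularAt_of_independent B _ y y' hy (fun z => ?_) (fun z => ?_) hyy') <;>
      rw [← hc, Units.smul_def, form_smul_left] <;> simp [h, h']
  · rintro ⟨c, rfl⟩ z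
    have : B.geom.form v (c • y) z = c * B.geom.form v y z := by
      simp only [Cube.form, Finset.mul_sum, Pi.smul_apply, smul_eq_mul]
      exact Finset.sum_congr rfl fun i _ => Finset.sum_congr rfl fun i _ =>
        Finset.sum_congr rfl fun i _ => by ring
    exact this.trans (by rw [h, mul_zero])

end Quartic

/-! ### Open parts of hypersurfaces are not finite -/

section InfinitelyManyPoints

open MvPolynomial

/-- Two coordinates other than `i` remain available, and some nonzero linear form in those two
vanishes on the line through `s`. -/
lemma exists_linearForm_vanishing {K : Type*} [Field K] (i : Fin 4) (s : Fin 4 → K) :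
    ∃ l : MvPolynomial (Fin 4) K, l ≠ 0 ∧ l.degreeOf i = 0 ∧
      ∀ c : K, MvPolynomial.eval (c • s) l = 0 := by
  obtain ⟨a, b, hab, ha, hb⟩ : ∃ a b : Fin 4, a ≠ b ∧ a ≠ i ∧ b ≠ i := by
    revert i; decide
  by_cases h : s a = 0
  · exact ⟨X a, X_ne_zero a, by simp [degreeOf_X, ha.symm], by simp [h]⟩
  · refine ⟨C (s b) * X a - C (s a) * X b, fun h0 => h ?_, ?_, fun c => by simp; ring⟩
    · have := congrArg (MvPolynomial.eval (Pi.single b 1)) h0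
      simpa [hab] using this
    · refine Nat.le_zero.mp ((degreeOf_sub_le _ _ _).trans (max_le ?_ ?_)) <;>
      refine (degreeOf_C_mul_le _ _ _).trans ?_ <;> simp [degreeOf_X, ha.symm, hb.symm]

lemma eq_C_of_degreeOf_eq_zero {K σ : Type*} [CommRing K] (g : MvPolynomial σ K)
    (h : ∀ i, g.degreeOf i = 0) : g = C (coeff 0 g) := by
  classical
  ext m
  rw [coeff_C]
  split_ifs with hm
  · rw [hm]
  · by_contra hne
    refine hm (Finsupp.ext fun i => ?_)
    have := monomial_le_degreeOf i (mem_support_iff.mpr hne)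
    rw [h i] at this
    exact (Nat.le_zero.mp this).symm

/-- A nonempty open subset of a hypersurface in projective space is not contained in a finite set of
points. -/
lemma exists_zero_avoiding_finite {F : Type*} [Field F] (f h : MvPolynomial (Fin 4) F)
    (hfh : h ∉ (Ideal.span {f}).radical) (S : Finset (Fin 4 → AlgebraicClosure F)) :
    ∃ v : Fin 4 → AlgebraicClosure F, aeval v f = 0 ∧ aeval v h ≠ 0 ∧
      ∀ s ∈ S, ∀ c : AlgebraicClosure F, v ≠ c • s := by
  classical
  let K := AlgebraicClosure F
  by_contra! H
  have hmem (p : MvPolynomial (Fin 4) F) (v : Fin 4 → K) :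
      MvPolynomial.eval v (map (algebraMap F K) p) = aeval v p := by rw [MvPolynomial.eval_map, aeval_def]
  set f' := map (algebraMap F K) f with hf'
  set h' := map (algebraMap F K) h with hh'
  obtain ⟨v, hvf, hvh⟩ : ∃ v : Fin 4 → K, aeval v f = 0 ∧ aeval v h ≠ 0 := by
    by_contra! H'
    refine hfh ?_
    rw [← vanishingIdeal_zeroLocus_eq_radical (K := K), mem_vanishingIdeal_iff]
    exact fun x hx => H' x (hx f (Ideal.mem_span_singleton_self f))
  -- If all zeros of `f` off `h = 0` lie on the lines spanned by `S`, then `h' * l` vanishes on all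
  -- of `f = 0` and the Nullstellensatz applies.
  have hdvd (l : MvPolynomial (Fin 4) K) (hl : ∀ s ∈ S, ∀ c : K, MvPolynomial.eval (c • s) l = 0) :
      ∃ n, f' ∣ (h' * l) ^ n := by
    have : h' * l ∈ (Ideal.span {f'}).radical := by
      rw [← vanishingIdeal_zeroLocus_eq_radical (K := K), mem_vanishingIdeal_iff]
      intro x hx
      have hxf : aeval x f = 0 := by
        rw [← hmem]; exact hx f' (Ideal.mem_span_singleton_self f')
      change MvPolynomial.eval x (h' * l) = 0
      rw [map_mul, hmem]
      by_cases hxh : aeval x h = 0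
      · rw [hxh, zero_mul]
      · obtain ⟨s, hs, c, rfl⟩ := H x hxf hxh
        rw [hl s hs c, mul_zero]
    obtain ⟨n, hn⟩ := this
    exact ⟨n, Ideal.mem_span_singleton.mp hn⟩
  have hL (i : Fin 4) : ∃ l : MvPolynomial (Fin 4) K, l ≠ 0 ∧ l.degreeOf i = 0 ∧
      ∀ s ∈ S, ∀ c : K, MvPolynomial.eval (c • s) l = 0 := by
    choose l hl0 hli hl using fun s => exists_linearForm_vanishing (K := K) i s
    refine ⟨∏ s ∈ S, l s, Finset.prod_ne_zero_iff.mpr fun s _ => hl0 s, ?_, fun s hs c => ?_⟩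
    · exact Nat.le_zero.mp ((degreeOf_prod_le i S l).trans (by simp [hli]))
    · rw [map_prod]
      exact Finset.prod_eq_zero hs (hl s c)
  choose L hL0 hLi hLS using hL
  have hh0 : h' ≠ 0 := fun h0 => hvh (by rw [← hmem, ← hh', h0, map_zero])
  have hf0 : f' ≠ 0 := by
    intro h0
    obtain ⟨n, hn⟩ := hdvd (L 0) (hLS 0)
    rw [h0, zero_dvd_iff] at hn
    exact mul_ne_zero hh0 (hL0 0) (eq_zero_of_pow_eq_zero hn)
  -- Some irreducible factor of `f'` vanishes at `v`; it cannot divide `h'`, which does not vanish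
  -- there.
  obtain ⟨g, hg, hgf, hgh⟩ : ∃ g, Irreducible g ∧ g ∣ f' ∧ ¬ g ∣ h' := by
    obtain ⟨w, hw⟩ := UniqueFactorizationMonoid.factors_prod hf0
    have h0 := congrArg (MvPolynomial.eval v) hw
    rw [map_mul, hmem, hvf, map_multiset_prod] at h0
    have h1 := (mul_eq_zero.mp h0).resolve_right
      (w.isUnit.map (MvPolynomial.eval v)).ne_zero
    obtain ⟨g, hg, hgv⟩ := Multiset.mem_map.mp (Multiset.prod_eq_zero_iff.mp h1)
    refine ⟨g, UniqueFactorizationMonoid.irreducible_of_factor g hg,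
      UniqueFactorizationMonoid.dvd_of_mem_factors hg, fun ⟨q, hq⟩ => hvh ?_⟩
    rw [← hmem, ← hh', hq, map_mul, hgv, zero_mul]
  have hgL (i) : g ∣ L i := by
    obtain ⟨n, hn⟩ := hdvd (L i) (hLS i)
    exact (hg.prime.dvd_or_dvd (hg.prime.dvd_of_dvd_pow (hgf.trans hn))).resolve_left hgh
  -- The factor `g` divides `L i`, which does not involve `X i`, for each `i`. So `g` involves no
  -- variable at all and is constant, which is absurd.
  have hdeg (i) : g.degreeOf i = 0 := by
    obtain ⟨q, hq⟩ := hgL i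
    have hne : g * q ≠ 0 := hq ▸ hL0 i
    have := degreeOf_mul_eq (n := i) (left_ne_zero_of_mul hne) (right_ne_zero_of_mul hne)
    rw [← hq, hLi] at this
    omega
  have hgC := eq_C_of_degreeOf_eq_zero g hdeg
  refine hg.not_isUnit ?_
  rw [hgC]
  refine (isUnit_iff_ne_zero.mpr fun h0 => hg.ne_zero ?_).map C
  rw [hgC, h0, map_zero]

end InfinitelyManyPoints


/-! ### Field-valued points and affine open subsets -/

section AffineLifts

variable {X : Scheme.{u}} {R S : CommRingCat.{u}}

lemma exists_SpecMap_comp_eq (ι : Spec R ⟶ X) [IsOpenImmersion ι] (q : Spec S ⟶ X)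
    (h : Set.range q ⊆ Set.range ι) : ∃ ρ : R ⟶ S, Spec.map ρ ≫ ι = q :=
  ⟨Spec.preimage (IsOpenImmersion.lift ι q h), by
    rw [Spec.map_preimage, IsOpenImmersion.lift_fac]⟩

lemma exists_SpecMap_comp_eq_of_mem {K : Type u} [Field K] (ι : Spec R ⟶ X) [IsOpenImmersion ι]
    (q : Spec (.of K) ⟶ X) (h : q default ∈ ι.opensRange) : ∃ ρ : R ⟶ .of K, Spec.map ρ ≫ ι = q := by
  refine exists_SpecMap_comp_eq ι q ?_
  rintro _ ⟨x, rfl⟩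
  rw [Subsingleton.elim x default]
  exact h

lemma SpecMap_default_mem_basicOpen_iff {K : Type u} [Field K] (ρ : R ⟶ .of K) (r : R) :
    Spec.map ρ default ∈ PrimeSpectrum.basicOpen r ↔ ρ.hom r ≠ 0 := by
  have hx (x : PrimeSpectrum K) : x.asIdeal = ⊥ := Ideal.eq_bot_of_prime _
  have h : Spec.map ρ default ∈ PrimeSpectrum.basicOpen r ↔
      default ∈ Spec.map ρ ⁻¹ᵁ PrimeSpectrum.basicOpen r := Iff.rfl
  rw [h, SpecMap_preimage_basicOpen]
  exact not_congr ((Ideal.ext_iff.mp (hx _) (ρ.hom r)).trans Ideal.mem_bot)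

end AffineLifts

/-! ### Field-valued points of `ℙ³` in the standard charts -/

section ProjectivePoints

variable {F : Type u} [Field F]

/-- The coordinate ring of the affine chart `D₊(X_i)` of `ℙ³`. -/
abbrev P3.Chart (F : Type u) [Field F] (i : Fin 4) : Type u :=
  HomogeneousLocalization.Away (MvPolynomial.homogeneousSubmodule (Fin 4) F)
    (MvPolynomial.X i : MvPolynomial (Fin 4) F)

lemma X_mem_homogeneousSubmodule (i : Fin 4) :
    (MvPolynomial.X i : MvPolynomial (Fin 4) F) ∈ MvPolynomial.homogeneousSubmodule (Fin 4) F 1 :=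
  MvPolynomial.isHomogeneous_X F i

/-- The standard affine chart `D₊(X_i)` of `ℙ³`. -/
def P3.chartι (F : Type u) [Field F] (i : Fin 4) : Spec (.of (P3.Chart F i)) ⟶ P3 F :=
  Proj.awayι (MvPolynomial.homogeneousSubmodule (Fin 4) F) (MvPolynomial.X i)
    (X_mem_homogeneousSubmodule i) one_pos

instance (i : Fin 4) : IsOpenImmersion (P3.chartι F i) := by
  unfold P3.chartι; infer_instance

lemma P3.opensRange_chartι (i : Fin 4) : (P3.chartι F i).opensRange =
    Proj.basicOpen (MvPolynomial.homogeneousSubmodule (Fin 4) F) (MvPolynomial.X i) :=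
  Proj.opensRange_awayι ..

/-- The coordinate function `X_j / X_i` on `D₊(X_i)`. -/
def P3.coord (i j : Fin 4) : P3.Chart F i :=
  HomogeneousLocalization.Away.mk (MvPolynomial.homogeneousSubmodule (Fin 4) F)
    (X_mem_homogeneousSubmodule i) 1 (MvPolynomial.X j)
    (by simpa using X_mem_homogeneousSubmodule j)

/-- Constants as functions on `D₊(X_i)`. -/
def P3.const (i : Fin 4) : F →+* P3.Chart F i :=
  (HomogeneousLocalization.fromZeroRingHom (MvPolynomial.homogeneousSubmodule (Fin 4) F) _).comp
    (algebraMap F (MvPolynomial.homogeneousSubmodule (Fin 4) F 0))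

lemma P3.coord_self (i : Fin 4) : P3.coord (F := F) i i = 1 := by
  apply HomogeneousLocalization.val_injective
  simp [P3.coord, HomogeneousLocalization.Away.val_mk]

lemma P3.chart_eval_ne_zero {K : Type u} [Field K] {i : Fin 4} (e : P3.Chart F i →+* K) :
    (fun j => e (P3.coord i j)) ≠ 0 := fun h => by
  simpa [P3.coord_self] using congrFun h i

lemma P3.chartι_toSpec (i : Fin 4) :
    P3.chartι F i ≫ P3.toSpec F = Spec.map (CommRingCat.ofHom (P3.const i)) := by
  rw [P3.chartι, P3.toSpec, Proj.awayι_toSpecZero_assoc, ← Spec.map_comp]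
  rfl

lemma P3.exists_mem_range_chartι (x : P3 F) : ∃ i, x ∈ (P3.chartι F i).opensRange := by
  have h := Proj.iSup_basicOpen_eq_top' (MvPolynomial.homogeneousSubmodule (Fin 4) F)
    (fun i : Fin 4 => (MvPolynomial.X i : MvPolynomial (Fin 4) F))
    (fun i => ⟨1, X_mem_homogeneousSubmodule i⟩) (by
      rw [eq_top_iff]
      intro p _
      induction p using MvPolynomial.induction_on with
      | C a =>
        exact (Algebra.adjoin _ _).algebraMap_mem
          (algebraMap F (MvPolynomial.homogeneousSubmodule (Fin 4) F 0) a)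
      | add p q hp hq => exact add_mem (hp trivial) (hq trivial)
      | mul_X p n hp => exact mul_mem (hp trivial) (Algebra.subset_adjoin ⟨n, rfl⟩))
  have hx : x ∈ (⊤ : (P3 F).Opens) := trivial
  rw [← h, TopologicalSpace.Opens.mem_iSup] at hx
  simpa only [P3.opensRange_chartι] using hx

variable {K : Type u} [Field K]

/-- The spectrum of a field has one point, so a morphism from it factors through any chart
containing its image. -/
lemma P3.exists_chart_eval (q : Spec (.of K) ⟶ P3 F) :
    ∃ (i : Fin 4) (e : P3.Chart F i →+* K), Spec.map (CommRingCat.ofHom e) ≫ P3.chartι F i = q := by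
  obtain ⟨i, hi⟩ := P3.exists_mem_range_chartι (q default)
  obtain ⟨ρ, hρ⟩ := exists_SpecMap_comp_eq_of_mem (P3.chartι F i) q hi
  exact ⟨i, ρ.hom, hρ⟩

variable [Algebra F K]

lemma P3.point_preimage_basicOpen {v : Fin 4 → K} (hv : v ≠ 0) {h : MvPolynomial (Fin 4) F} {n : ℕ}
    (hn : 0 < n) (hh : h.IsHomogeneous n) (x : Spec (.of K)) :
    P3.point (F := F) v hv x ∈ Proj.basicOpen (MvPolynomial.homogeneousSubmodule (Fin 4) F) h ↔
      MvPolynomial.aeval v h ≠ 0 := by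
  have := Proj.fromOfGlobalSections_preimage_basicOpen _ (evalAt (F := F) v)
    (map_irrelevant_evalAt hv) hn hh
  change x ∈ Proj.fromOfGlobalSections _ (evalAt (F := F) v) (map_irrelevant_evalAt hv) ⁻¹ᵁ
    Proj.basicOpen _ h ↔ _
  have h' : (Spec (.of K)).basicOpen (evalAt v h) =
      PrimeSpectrum.basicOpen (MvPolynomial.aeval v h) :=
    basicOpen_eq_of_affine (R := .of K) (MvPolynomial.aeval v h)
  rw [this, h']
  refine (PrimeSpectrum.mem_basicOpen _ _).trans ?_
  have hx : PrimeSpectrum.asIdeal (R := K) x = ⊥ :=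
    have := PrimeSpectrum.isPrime (R := K) x
    Ideal.eq_bot_of_prime _
  exact not_congr ((Ideal.ext_iff.mp hx _).trans Ideal.mem_bot)

lemma P3.point_toSpec {v : Fin 4 → K} (hv : v ≠ 0) :
    P3.point (F := F) v hv ≫ P3.toSpec F = Spec.map (CommRingCat.ofHom (algebraMap F K)) := by
  rw [P3.point, P3.toSpec, Proj.fromOfGlobalSections_toSpecZero_assoc, ← Spec.map_comp]
  have : (CommRingCat.ofHom (algebraMap F (MvPolynomial.homogeneousSubmodule (Fin 4) F 0)) ≫
      CommRingCat.ofHom ((evalAt (F := F) v).comp (algebraMap _ _))) =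
      CommRingCat.ofHom (algebraMap F K) ≫ (Scheme.ΓSpecIso (.of K)).inv := by
    ext c
    change (Scheme.ΓSpecIso (.of K)).inv.hom (MvPolynomial.aeval v (algebraMap F (MvPolynomial (Fin 4) F) c)) = _
    rw [AlgHom.commutes]
    rfl
  rw [this, Spec.map_comp]
  exact (toSpecΓ_SpecMap_ΓSpecIso_inv_assoc ..)

lemma P3.chart_eval_const {q : Spec (.of K) ⟶ P3 F}
    (hq : q ≫ P3.toSpec F = Spec.map (CommRingCat.ofHom (algebraMap F K))) {i : Fin 4}
    {e : P3.Chart F i →+* K} (he : Spec.map (CommRingCat.ofHom e) ≫ P3.chartι F i = q) (c : F) :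
    e (P3.const i c) = algebraMap F K c := by
  rw [← he, Category.assoc, P3.chartι_toSpec, ← Spec.map_comp] at hq
  exact congr($(Spec.map_injective hq).hom c)

/-- This links the scheme-theoretic point to its homogeneous coordinates: a chart sees the vector
rescaled so that its `i`-th entry is `1`. -/
lemma P3.chart_eval_coord {v : Fin 4 → K} (hv : v ≠ 0) {i : Fin 4}
    {e : P3.Chart F i →+* K}
    (he : Spec.map (CommRingCat.ofHom e) ≫ P3.chartι F i = P3.point v hv) :
    v i ≠ 0 ∧ ∀ j, e (P3.coord i j) = v j / v i := by
  have hi : v i ≠ 0 := by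
    have := (P3.point_preimage_basicOpen (F := F) hv one_pos (MvPolynomial.isHomogeneous_X F i)
      default).mp (by
        rw [← P3.opensRange_chartι, ← he]
        exact ⟨_, rfl⟩)
    simpa using this
  refine ⟨hi, fun j => ?_⟩
  -- Evaluation at `v`, extended to fractions with powers of `X i` in the denominator. Its
  -- restriction to degree zero is shown to induce the point, and `e` then agrees with it because
  -- the chart is a monomorphism.
  let L : Localization.Away (MvPolynomial.X i : MvPolynomial (Fin 4) F) →+* K :=
    IsLocalization.Away.lift (MvPolynomial.X i) (g := (MvPolynomial.aeval (R := F) v).toRingHom)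
      (by simpa using hi)
  have h : Spec.map (CommRingCat.ofHom (L.comp (algebraMap (P3.Chart F i) _))) ≫ P3.chartι F i =
      P3.point v hv := by
    -- As `v i ≠ 0`, this basic open subset is the whole spectrum, so the morphism can be compared
    -- after restriction to it.
    have hx : (Spec (.of K)).basicOpen (evalAt (F := F) v (MvPolynomial.X i)) = ⊤ := by
      ext x
      have := P3.point_preimage_basicOpen (F := F) hv one_pos (MvPolynomial.isHomogeneous_X F i) x
      rw [← Proj.fromOfGlobalSections_preimage_basicOpen _ (evalAt (F := F) v)
        (map_irrelevant_evalAt hv) one_pos (X_mem_homogeneousSubmodule i)]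
      exact iff_of_true (this.mpr (by simpa using hi)) trivial
    have hU : IsIso ((Spec (.of K)).basicOpen (evalAt (F := F) v (MvPolynomial.X i))).ι := by
      rw [hx]; exact inferInstanceAs (IsIso (Scheme.topIso _).hom)
    rw [← cancel_epi ((Spec (.of K)).basicOpen (evalAt (F := F) v (MvPolynomial.X i))).ι]
    have h2 := Proj.fromOfGlobalSections_resLE _ (evalAt (F := F) v)
      (map_irrelevant_evalAt hv) one_pos (X_mem_homogeneousSubmodule i)
    have h3 := congr($h2 ≫ (Proj.basicOpen _ (MvPolynomial.X i)).ι)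
    rw [Scheme.Hom.resLE_comp_ι] at h3
    rw [P3.point, h3, Proj.toBasicOpenOfGlobalSections, P3.chartι]
    simp only [Category.assoc, Proj.basicOpenIsoSpec_inv_ι]
    have hs : IsUnit ((Scheme.ΓSpecIso (.of K)).hom.hom (evalAt (F := F) v (MvPolynomial.X i))) := by
      simpa [evalAt] using hi
    let u : Localization.Away (evalAt (F := F) v (MvPolynomial.X i) : Γ(Spec (.of K), ⊤)) →+* K :=
      IsLocalization.Away.lift (evalAt (F := F) v (MvPolynomial.X i))
        (g := (Scheme.ΓSpecIso (.of K)).hom.hom) hs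
    have hu : CommRingCat.ofHom (algebraMap Γ(Spec (.of K), ⊤) _) ≫ CommRingCat.ofHom u =
        (Scheme.ΓSpecIso (.of K)).hom := by
      ext x
      exact IsLocalization.Away.lift_eq _ hs x
    have : IsOpenImmersion (Spec.map (CommRingCat.ofHom (algebraMap Γ(Spec (.of K), ⊤)
        (Localization.Away (evalAt (F := F) v (MvPolynomial.X i)))))) :=
      IsOpenImmersion.of_isLocalization (evalAt (F := F) v (MvPolynomial.X i))
    have h4 : ((Spec (.of K)).isoOfEq ((Spec (.of K)).toSpecΓ_preimage_basicOpen
          (evalAt (F := F) v (MvPolynomial.X i)))).inv ≫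
        (Spec (.of K)).toSpecΓ ∣_ _ ≫ (basicOpenIsoSpecAway (evalAt (F := F) v
          (MvPolynomial.X i))).hom =
        ((Spec (.of K)).basicOpen (evalAt (F := F) v (MvPolynomial.X i))).ι ≫
          Spec.map (CommRingCat.ofHom u) := by
      rw [← cancel_mono (Spec.map (CommRingCat.ofHom (algebraMap Γ(Spec (.of K), ⊤)
        (Localization.Away (evalAt (F := F) v (MvPolynomial.X i))))))]
      simp only [Category.assoc]
      rw [basicOpenIsoSpecAway_hom_SpecMap, ← Spec.map_comp, hu,
        SpecMap_ΓSpecIso_hom]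
      refine congr(_ ≫ $(morphismRestrict_ι _ _)).trans ?_
      exact Scheme.isoOfEq_inv_ι_assoc ..
    have h5 : L = u.comp (IsLocalization.map
        (M := .powers (MvPolynomial.X i : MvPolynomial (Fin 4) F))
        (T := .powers (evalAt (F := F) v (MvPolynomial.X i)))
        (Localization.Away (evalAt (F := F) v (MvPolynomial.X i))) (evalAt (F := F) v) (by
          rw [← Submonoid.map_le_iff_le_comap, Submonoid.map_powers])) := by
      refine IsLocalization.ringHom_ext
        (M := .powers (MvPolynomial.X i : MvPolynomial (Fin 4) F)) ?_
      refine RingHom.ext fun x => ?_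
      rw [RingHom.comp_apply, RingHom.comp_apply, RingHom.comp_apply, IsLocalization.map_eq]
      refine (IsLocalization.Away.lift_eq _ _ x).trans
        (Eq.trans ?_ (IsLocalization.Away.lift_eq _ hs _).symm)
      exact congr($((Scheme.ΓSpecIso (.of K)).inv_hom_id.symm).hom (MvPolynomial.aeval v x))
    rw [h5, RingHom.comp_assoc, CommRingCat.ofHom_comp, Spec.map_comp, Category.assoc,
      ← reassoc_of% h4]
  rw [← h, cancel_mono] at he
  have he' : e = L.comp (algebraMap (P3.Chart F i) _) := congr($(Spec.map_injective he).hom)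
  rw [he']
  have : algebraMap (P3.Chart F i)
      (Localization.Away (MvPolynomial.X i : MvPolynomial (Fin 4) F)) (P3.coord i j) *
      algebraMap (MvPolynomial (Fin 4) F) _ (MvPolynomial.X i) =
      algebraMap (MvPolynomial (Fin 4) F) _ (MvPolynomial.X j) := by
    rw [HomogeneousLocalization.algebraMap_apply, P3.coord, HomogeneousLocalization.Away.val_mk,
      Localization.mk_eq_mk']
    simp
  have h' := congrArg L this
  rw [map_mul] at h'
  simp only [L, IsLocalization.Away.lift_eq] at h'
  rw [eq_div_iff hi]
  simpa [L] using h'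

lemma exists_lift_point_surface {v : Fin 4 → K} (hv : v ≠ 0) {f : MvPolynomial (Fin 4) F} {n : ℕ}
    (hn : 0 < n) (hf : f.IsHomogeneous n) (hfv : MvPolynomial.aeval v f = 0) :
    ∃ s : Spec (.of K) ⟶ surface f, s ≫ surfaceι f = P3.point v hv := by
  have hmem (x) : P3.point (F := F) v hv x ∈ vanishingLocus f := by
    have := (P3.point_preimage_basicOpen hv hn hf x).not.mpr (not_not.mpr hfv)
    rw [Proj.mem_basicOpen, not_not] at this
    exact Set.singleton_subset_iff.mpr this
  have hcl : IsClosedImmersion (surfaceι f) :=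
    inferInstanceAs (IsClosedImmersion (Scheme.IdealSheafData.subschemeι _))
  have hker : (surfaceι f).ker = Scheme.IdealSheafData.vanishingIdeal (vanishingLocus f) :=
    Scheme.IdealSheafData.ker_subschemeι _
  refine ⟨IsClosedImmersion.lift (surfaceι f) (P3.point v hv) ?_, IsClosedImmersion.lift_fac ..⟩
  rw [hker, Scheme.Hom.ker,
    Scheme.IdealSheafData.le_ofIdeals_iff]
  rintro ⟨U, hU⟩ t ht
  change IsAffineOpen U at hU
  rw [RingHom.mem_ker]
  -- The spectrum of a field is reduced, so the pullback of `t` is zero once its nonvanishing locus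
  -- is empty.
  refine (basicOpen_eq_bot_iff _).mp ?_
  rw [← Scheme.preimage_basicOpen]
  ext x
  refine iff_of_false (fun hx => ?_) id
  have hxU : P3.point (F := F) v hv x ∈ Set.range hU.fromSpec := by
    rw [hU.range_fromSpec]
    exact Scheme.basicOpen_le _ _ hx
  obtain ⟨x', hx'⟩ := hxU
  have h1 : x' ∈ PrimeSpectrum.basicOpen t := by
    rw [← hU.fromSpec_preimage_basicOpen]
    change hU.fromSpec x' ∈ (P3 F).basicOpen t
    rw [hx']
    exact hx
  refine h1 (PrimeSpectrum.mem_vanishingIdeal _ _ |>.mp ht x' ?_)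
  change hU.fromSpec x' ∈ vanishingLocus f
  rw [hx']
  exact hmem x

end ProjectivePoints


/-! ### Density of geometric points where `ψ₁₂` is defined, and extension of its equations -/

variable {F : Type u} [Field F]

lemma surfaceι_mem_vanishingLocus {f : MvPolynomial (Fin 4) F} (x : surface f) :
    surfaceι f x ∈ vanishingLocus f := by
  have h : Set.range (surfaceι f) =
      (Scheme.IdealSheafData.vanishingIdeal (vanishingLocus f)).support :=
    Scheme.IdealSheafData.range_subschemeι _
  have hx : surfaceι f x ∈ Set.range (surfaceι f) := ⟨x, rfl⟩
  rw [h] at hx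
  simpa using hx

/-- A nonempty open subset of a surface in `ℙ³` contains geometric points outside any given finite
set. -/
lemma exists_geometricPoint_avoiding_finite {f : MvPolynomial (Fin 4) F} {n : ℕ} (hn : 0 < n)
    (hf : f.IsHomogeneous n) (V : (surface f).Opens) {ξ : surface f} (hξ : ξ ∈ V)
    {S : Set (Projectivization (AlgebraicClosure F) (Fin 4 → AlgebraicClosure F))}
    (hS : S.Finite) :
    ∃ (v : Fin 4 → AlgebraicClosure F) (hv : v ≠ 0)
      (s : Spec (.of (AlgebraicClosure F)) ⟶ surface f), s ≫ surfaceι f = P3.point v hv ∧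
        s default ∈ V ∧ MvPolynomial.aeval v f = 0 ∧
        Projectivization.mk (AlgebraicClosure F) v hv ∉ S := by
  classical
  have hemb : IsPreimmersion (surfaceι f) :=
    inferInstanceAs (IsPreimmersion (Scheme.IdealSheafData.subschemeι _))
  obtain ⟨W, hW, hWV⟩ := (surfaceι f).isEmbedding.isOpen_iff.mp V.2
  have hξW : surfaceι f ξ ∈ W := by
    change ξ ∈ surfaceι f ⁻¹' W
    rw [hWV]; exact hξ
  obtain ⟨_, ⟨h, rfl⟩, hξh, hhW⟩ :=
    (ProjectiveSpectrum.isTopologicalBasis_basic_opens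
      (MvPolynomial.homogeneousSubmodule (Fin 4) F)).exists_subset_of_mem_open hξW hW
  -- The function `h` need not be homogeneous; some homogeneous component of it is still nonzero at
  -- `ξ`.
  obtain ⟨d, hd, hd', hdh⟩ : ∃ d : MvPolynomial (Fin 4) F,
      surfaceι f ξ ∈ Proj.basicOpen (MvPolynomial.homogeneousSubmodule (Fin 4) F) d ∧
      (∃ m, d.IsHomogeneous m) ∧
      Proj.basicOpen (MvPolynomial.homogeneousSubmodule (Fin 4) F) d ≤
        Proj.basicOpen (MvPolynomial.homogeneousSubmodule (Fin 4) F) h := by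
    have hξh' : surfaceι f ξ ∈ Proj.basicOpen (MvPolynomial.homogeneousSubmodule (Fin 4) F) h := hξh
    rw [Proj.basicOpen_eq_iSup_proj, TopologicalSpace.Opens.mem_iSup] at hξh'
    obtain ⟨m, hm⟩ := hξh'
    refine ⟨_, hm, ⟨m, SetLike.coe_mem
      (DirectSum.decompose (MvPolynomial.homogeneousSubmodule (Fin 4) F) h m)⟩, ?_⟩
    rw [Proj.basicOpen_eq_iSup_proj _ h]
    exact le_iSup (fun m => Proj.basicOpen (MvPolynomial.homogeneousSubmodule (Fin 4) F)
      (GradedRing.proj _ m h)) m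
  obtain ⟨m, hm⟩ := hd'
  -- The component may have degree zero; a further factor `X i` not vanishing at `ξ` makes the
  -- degree positive.
  obtain ⟨i, hi⟩ := P3.exists_mem_range_chartι (surfaceι f ξ)
  rw [P3.opensRange_chartι] at hi
  have hdi : surfaceι f ξ ∈
      Proj.basicOpen (MvPolynomial.homogeneousSubmodule (Fin 4) F) (d * MvPolynomial.X i) := by
    rw [Proj.basicOpen_mul]; exact ⟨hd, hi⟩
  have hrad : d * MvPolynomial.X i ∉ (Ideal.span {f}).radical := by
    intro hr
    have hfξ : f ∈ (surfaceι f ξ).asHomogeneousIdeal.toIdeal :=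
      Set.singleton_subset_iff.mp (surfaceι_mem_vanishingLocus ξ)
    have := (surfaceι f ξ).isPrime.radical_le_iff.mpr
      ((Ideal.span_singleton_le_iff_mem _).mpr hfξ) hr
    exact hdi this
  -- Adding `0` to the set to be avoided forces `v ≠ 0`.
  obtain ⟨v, hvf, hvd, hvS⟩ := exists_zero_avoiding_finite f _ hrad
    (insert 0 (hS.toFinset.image Projectivization.rep))
  have hv : v ≠ 0 := by simpa using hvS 0 (Finset.mem_insert_self _ _) 0
  obtain ⟨s, hs⟩ := exists_lift_point_surface hv hn hf hvf
  refine ⟨v, hv, s, hs, ?_, hvf, fun hmem => ?_⟩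
  · change s default ∈ V.carrier
    rw [← hWV]
    refine hhW (hdh ?_)
    have h1 := (P3.point_preimage_basicOpen hv (Nat.succ_pos m)
      (hm.mul (MvPolynomial.isHomogeneous_X F i)) default).mpr hvd
    rw [← hs, Proj.basicOpen_mul] at h1
    exact h1.1
  · obtain ⟨c, hc⟩ := Projectivization.exists_smul_eq_mk_rep (AlgebraicClosure F) v hv
    refine hvS _ (Finset.mem_insert_of_mem (Finset.mem_image_of_mem _
      (hS.mem_toFinset.mpr hmem))) (↑c⁻¹ : AlgebraicClosure F) ?_
    rw [← hc, Units.smul_def, smul_smul, Units.inv_mul, one_smul]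

/-- A nonempty open subset of a nonsingular model contains a geometric point lying over a point of
the surface outside any given finite set. -/
lemma NonsingularModel.exists_geometricPoint {f : MvPolynomial (Fin 4) F} {n : ℕ} (hn : 0 < n)
    (hf : f.IsHomogeneous n) (M : NonsingularModel f) (W : M.scheme.Opens) {w : M.scheme}
    (hw : w ∈ W)
    {S : Set (Projectivization (AlgebraicClosure F) (Fin 4 → AlgebraicClosure F))}
    (hS : S.Finite) :
    ∃ (v : Fin 4 → AlgebraicClosure F) (hv : v ≠ 0)
      (p : Spec (.of (AlgebraicClosure F)) ⟶ M.scheme), p ≫ M.π ≫ surfaceι f = P3.point v hv ∧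
        M.IsGeometricPoint p ∧ p default ∈ W ∧ MvPolynomial.aeval v f = 0 ∧
        Projectivization.mk (AlgebraicClosure F) v hv ∉ S := by
  obtain ⟨U, -, hU, hiso⟩ := M.birational
  obtain ⟨w', hw'W, hw'U⟩ := hU.inter_open_nonempty W W.2 ⟨w, hw⟩
  have hj : (M.π ⁻¹ᵁ U).ι ≫ M.π = M.π ∣_ U ≫ U.ι := (morphismRestrict_ι M.π U).symm
  have hji : IsOpenImmersion ((M.π ⁻¹ᵁ U).ι ≫ M.π) := by rw [hj]; infer_instance
  -- Over `U` the model is an open part of the surface, so a geometric point of the image of `W`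
  -- lifts back to `W`.
  obtain ⟨v, hv, s, hs, hsV, hvf, hvS⟩ := exists_geometricPoint_avoiding_finite hn hf
    (((M.π ⁻¹ᵁ U).ι ≫ M.π) ''ᵁ ((M.π ⁻¹ᵁ U).ι ⁻¹ᵁ W))
    (ξ := ((M.π ⁻¹ᵁ U).ι ≫ M.π) ⟨w', hw'U⟩) ⟨⟨w', hw'U⟩, hw'W, rfl⟩ hS
  have hrange : Set.range s ⊆ Set.range ((M.π ⁻¹ᵁ U).ι ≫ M.π) := by
    rintro _ ⟨x, rfl⟩
    rw [Subsingleton.elim x default]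
    obtain ⟨y, -, hy⟩ := hsV
    exact ⟨y, hy⟩
  have hlift := IsOpenImmersion.lift_fac ((M.π ⁻¹ᵁ U).ι ≫ M.π) s hrange
  have hp : (IsOpenImmersion.lift ((M.π ⁻¹ᵁ U).ι ≫ M.π) s hrange ≫ (M.π ⁻¹ᵁ U).ι) ≫ M.π ≫
      surfaceι f = P3.point v hv := by
    rw [← hs, Category.assoc, ← Category.assoc (M.π ⁻¹ᵁ U).ι, ← Category.assoc, hlift]
  refine ⟨v, hv, _, hp, ?_, ?_, hvf, hvS⟩
  · rw [NonsingularModel.IsGeometricPoint, NonsingularModel.toSpec, ← P3.point_toSpec hv, ← hp]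
    simp only [Category.assoc]
  · obtain ⟨y, hyW, hy⟩ := hsV
    have hy : ((M.π ⁻¹ᵁ U).ι ≫ M.π) y = s default := hy
    have : IsOpenImmersion.lift ((M.π ⁻¹ᵁ U).ι ≫ M.π) s hrange default = y := by
      refine ((M.π ⁻¹ᵁ U).ι ≫ M.π).isOpenEmbedding.injective ?_
      rw [← Scheme.Hom.comp_apply, hlift, hy]
    rw [Scheme.Hom.comp_apply, this]
    exact hyW

/-- The graph of a lift of `ψ₁₂` satisfies the equations `B(x, y, ·) = 0` everywhere, not only
where `ψ₁₂` is defined. -/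
lemma IsLift.form_eq_zero {B : Cube F} {f g : MvPolynomial (Fin 4) F} (hf : f = B.quartic₁)
    (hfin : OnlyIsolatedDoublePoints f) {M : NonsingularModel f} {N : NonsingularModel g}
    {Ψ : M.scheme ≅ N.scheme} (hΨ : IsLift B.psi₁₂ M N Ψ)
    {p : Spec (.of (AlgebraicClosure F)) ⟶ M.scheme} (hp : M.IsGeometricPoint p) {i j : Fin 4}
    {e : P3.Chart F i →+* AlgebraicClosure F} {e' : P3.Chart F j →+* AlgebraicClosure F}
    (he : Spec.map (CommRingCat.ofHom e) ≫ P3.chartι F i = p ≫ M.π ≫ surfaceι f)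
    (he' : Spec.map (CommRingCat.ofHom e') ≫ P3.chartι F j = (p ≫ Ψ.hom) ≫ N.π ≫ surfaceι g)
    (z : Fin 4 → AlgebraicClosure F) :
    B.geom.form (fun a => e (P3.coord i a)) (fun b => e' (P3.coord j b)) z = 0 := by
  suffices hk : ∀ k, ∑ a, ∑ b, algebraMap F (AlgebraicClosure F) (B a b k) * e (P3.coord i a) *
      e' (P3.coord j b) = 0 by
    simp only [Cube.form, Cube.geom]
    refine (Finset.sum_congr rfl fun a _ => Finset.sum_comm).trans ?_
    rw [Finset.sum_comm]
    refine Finset.sum_eq_zero fun k _ => ?_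
    simp_rw [← Finset.sum_mul]
    rw [hk, zero_mul]
  intro k
  let φ : M.scheme ⟶ P3 F := M.π ≫ surfaceι f
  let φ' : M.scheme ⟶ P3 F := Ψ.hom ≫ N.π ≫ surfaceι g
  have hpφ : p default ∈ φ ⁻¹ᵁ (P3.chartι F i).opensRange := by
    change φ (p default) ∈ (P3.chartι F i).opensRange
    rw [← Scheme.Hom.comp_apply, ← he]
    exact ⟨_, rfl⟩
  have hpφ' : p default ∈ φ' ⁻¹ᵁ (P3.chartι F j).opensRange := by
    change φ' (p default) ∈ (P3.chartι F j).opensRange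
    rw [← Scheme.Hom.comp_apply, ← Category.assoc, ← he']
    exact ⟨_, rfl⟩
  obtain ⟨_, ⟨U, hU, rfl⟩, hpU, hUφ⟩ := M.scheme.isBasis_affineOpens.exists_subset_of_mem_open
    (show p default ∈ (φ ⁻¹ᵁ (P3.chartι F i).opensRange ⊓ φ' ⁻¹ᵁ (P3.chartι F j).opensRange :
      M.scheme.Opens) from ⟨hpφ, hpφ'⟩) (TopologicalSpace.Opens.isOpen _)
  change IsAffineOpen U at hU
  have hrange (x) : hU.fromSpec x ∈ U := by
    have : hU.fromSpec x ∈ Set.range hU.fromSpec := ⟨x, rfl⟩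
    rwa [hU.range_fromSpec] at this
  obtain ⟨α, hα⟩ := exists_SpecMap_comp_eq (P3.chartι F i) (hU.fromSpec ≫ φ) (by
    rintro _ ⟨x, rfl⟩
    exact (hUφ (hrange x)).1)
  obtain ⟨α', hα'⟩ := exists_SpecMap_comp_eq (P3.chartι F j) (hU.fromSpec ≫ φ') (by
    rintro _ ⟨x, rfl⟩
    exact (hUφ (hrange x)).2)
  -- The `k`-th coefficient of `B(x, y, ·)` as a regular function on an affine neighbourhood of `p`,
  -- in the chart coordinates of both images.
  let r : Γ(M.scheme, U) := ∑ a, ∑ b, α.hom (P3.const i (B a b k)) * α.hom (P3.coord i a) *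
      α'.hom (P3.coord j b)
  have hlift (q : Spec (.of (AlgebraicClosure F)) ⟶ M.scheme) (hq : q default ∈ U) :
      ∃ ρ : Γ(M.scheme, U) ⟶ .of (AlgebraicClosure F), Spec.map ρ ≫ hU.fromSpec = q :=
    exists_SpecMap_comp_eq_of_mem hU.fromSpec q (by rwa [hU.opensRange_fromSpec])
  have heval (q : Spec (.of (AlgebraicClosure F)) ⟶ M.scheme) (hq : M.IsGeometricPoint q)
      (ρ : Γ(M.scheme, U) ⟶ .of (AlgebraicClosure F)) (hρ : Spec.map ρ ≫ hU.fromSpec = q) :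
      Spec.map (CommRingCat.ofHom (α ≫ ρ).hom) ≫ P3.chartι F i = q ≫ M.π ≫ surfaceι f ∧
      Spec.map (CommRingCat.ofHom (α' ≫ ρ).hom) ≫ P3.chartι F j =
        (q ≫ Ψ.hom) ≫ N.π ≫ surfaceι g ∧
      ρ.hom r = ∑ a, ∑ b, algebraMap F (AlgebraicClosure F) (B a b k) *
        (α ≫ ρ).hom (P3.coord i a) * (α' ≫ ρ).hom (P3.coord j b) := by
    have h1 : Spec.map (CommRingCat.ofHom (α ≫ ρ).hom) ≫ P3.chartι F i = q ≫ M.π ≫ surfaceι f := by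
      rw [CommRingCat.ofHom_hom, Spec.map_comp, Category.assoc, hα, reassoc_of% hρ]
    have h2 : Spec.map (CommRingCat.ofHom (α' ≫ ρ).hom) ≫ P3.chartι F j =
        (q ≫ Ψ.hom) ≫ N.π ≫ surfaceι g := by
      rw [CommRingCat.ofHom_hom, Spec.map_comp, Category.assoc, hα', reassoc_of% hρ,
        Category.assoc]
    refine ⟨h1, h2, ?_⟩
    simp only [r, map_sum, map_mul]
    refine Finset.sum_congr rfl fun a _ => Finset.sum_congr rfl fun b _ => ?_
    have h3 := P3.chart_eval_const (q := q ≫ M.π ≫ surfaceι f)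
      (by simpa [NonsingularModel.IsGeometricPoint, NonsingularModel.toSpec] using hq) h1 (B a b k)
    rw [← h3]
    rfl
  obtain ⟨ρ, hρ⟩ := hlift p hpU
  obtain ⟨h1, h2, h3⟩ := heval p hp ρ hρ
  rw [← h1, cancel_mono] at he
  rw [← h2, cancel_mono] at he'
  have he : e = (α ≫ ρ).hom := congr($(Spec.map_injective he).hom)
  have he' : e' = (α' ≫ ρ).hom := congr($(Spec.map_injective he').hom)
  rw [he, he', ← h3]
  by_contra hne
  -- If `r` were nonzero at `p`, its nonvanishing locus would contain a geometric point `q` over a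
  -- point at which `ψ₁₂` is defined. There the lift property forces `r` to vanish.
  have hw : p default ∈ hU.fromSpec ''ᵁ PrimeSpectrum.basicOpen r :=
    ⟨Spec.map ρ default, (SpecMap_default_mem_basicOpen_iff ρ r).mpr hne, by
      change hU.fromSpec (Spec.map ρ default) = p default
      rw [← Scheme.Hom.comp_apply, hρ]⟩
  obtain ⟨v, hv, q, hqv, hq, hqW, hvf, hvS⟩ := M.exists_geometricPoint (n := 4) (by norm_num)
    (hf ▸ quartic₁_isHomogeneous B) _ hw hfin.1
  subst hf
  obtain ⟨y, hy⟩ := exists_psi₁₂ B v hv hvf hvS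
  obtain ⟨t, ht, htq⟩ := hqW
  change hU.fromSpec t = q default at htq
  obtain ⟨ρ', hρ'⟩ := hlift q (htq ▸ hrange t)
  obtain ⟨h1', h2', h3'⟩ := heval q hq ρ' hρ'
  obtain ⟨hy0, hqy⟩ := hΨ.lift q hq v y ⟨hv, hqv⟩ hy
  rw [hqv] at h1'
  rw [hqy] at h2'
  obtain ⟨hvi, hv'⟩ := P3.chart_eval_coord hv h1'
  obtain ⟨hyj, hy'⟩ := P3.chart_eval_coord hy0 h2'
  have hr0 : ρ'.hom r ≠ 0 := by
    rw [← SpecMap_default_mem_basicOpen_iff]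
    have : Spec.map ρ' default = t := by
      refine hU.fromSpec.isOpenEmbedding.injective ?_
      rw [← Scheme.Hom.comp_apply, hρ', htq]
    rw [this]; exact ht
  refine hr0 (h3'.trans ?_)
  have hform := (hy.2 y).mpr ⟨1, (one_smul _ _).symm⟩ (Pi.single k 1)
  simp only [hv', hy']
  -- Clearing the denominators `v i` and `y j` turns the value of `r` at `q` into `B(v, y, ·)` at
  -- the `k`-th basis vector.
  rw [← mul_right_inj' (mul_ne_zero hvi hyj), mul_zero, ← hform]
  simp only [Cube.form, Cube.geom, Finset.mul_sum]
  refine Finset.sum_congr rfl fun a _ => Finset.sum_congr rfl fun b _ => ?_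
  simp only [Pi.single_apply, mul_ite, mul_one, mul_zero, Finset.sum_ite_eq', Finset.mem_univ,
    if_true]
  field_simp

/-- The cyclic rotation `(y, z, x) ↦ A(x, y, z)`. -/
def Cube.rotate (A : Cube F) : Cube F := fun j k i => A i j k

lemma Cube.form_geom_rotate (A : Cube F) (x y z : Fin 4 → AlgebraicClosure F) :
    A.rotate.geom.form y z x = A.geom.form x y z := by
  simp only [Cube.form, Cube.geom, Cube.rotate]
  refine (Finset.sum_congr rfl fun j _ => Finset.sum_comm).trans ?_
  rw [Finset.sum_comm]
  exact Finset.sum_congr rfl fun i _ => Finset.sum_congr rfl fun j _ =>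
    Finset.sum_congr rfl fun k _ => by ring

/-- Rotation interchanges rows and columns of the defining matrix here, hence the transpose; after
two rotations the order agrees again. -/
lemma Cube.quartic₁_rotate (A : Cube F) : A.quartic₂ = A.rotate.quartic₁ := by
  rw [Cube.quartic₁, ← Matrix.det_transpose]
  rfl

lemma Cube.quartic₁_rotate_rotate (A : Cube F) : A.quartic₃ = A.rotate.rotate.quartic₁ := rfl

lemma Cube.psi₁₂_rotate (A : Cube F) : A.psi₂₃ = A.rotate.psi₁₂ := by
  ext y z
  simp only [Cube.psi₂₃, Cube.psi₁₂, Cube.form_geom_rotate]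

lemma Cube.psi₁₂_rotate_rotate (A : Cube F) : A.psi₃₁ = A.rotate.rotate.psi₁₂ := by
  ext y z
  simp only [Cube.psi₃₁, Cube.psi₁₂, Cube.form_geom_rotate]

lemma evalCube_eq_zero_of_geom {D : MvPolynomial (Fin 4 × Fin 4 × Fin 4) F} {A : Cube F}
    (h : evalCube D A.geom = 0) : evalCube D A = 0 := by
  refine (algebraMap F (AlgebraicClosure F)).injective ?_
  rw [map_zero, ← h]
  exact (MvPolynomial.aeval_algebraMap_apply (AlgebraicClosure F)
    (fun m : Fin 4 × Fin 4 × Fin 4 => A m.1 m.2.1 m.2.2) D).symm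

end RubiksRevenge

end

/-! ### From a fixed point to a kernel -/

theorem theorem8p3 {F : Type u} [Field F] [CharZero F] (T : Cube F)
    (h₁ : OnlyIsolatedDoublePoints T.quartic₁)
    (h₂ : OnlyIsolatedDoublePoints T.quartic₂)
    (h₃ : OnlyIsolatedDoublePoints T.quartic₃)
    (M₁ : NonsingularModel T.quartic₁)
    (M₂ : NonsingularModel T.quartic₂)
    (M₃ : NonsingularModel T.quartic₃)
    (Ψ₁₂ : M₁.scheme ≅ M₂.scheme) (h₁₂ : IsLift T.psi₁₂ M₁ M₂ Ψ₁₂)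
    (Ψ₂₃ : M₂.scheme ≅ M₃.scheme) (h₂₃ : IsLift T.psi₂₃ M₂ M₃ Ψ₂₃)
    (Ψ₃₁ : M₃.scheme ≅ M₁.scheme) (h₃₁ : IsLift T.psi₃₁ M₃ M₁ Ψ₃₁)
    (D : MvPolynomial (Fin 4 × Fin 4 × Fin 4) F) (hD : IsHyperdeterminant D) :
    (M₁.HasFixedPoint (Ψ₁₂ ≪≫ Ψ₂₃ ≪≫ Ψ₃₁) → evalCube D T = 0) ∧
      (evalCube D T ≠ 0 → ¬ M₁.HasFixedPoint (Ψ₁₂ ≪≫ Ψ₂₃ ≪≫ Ψ₃₁)) := by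
  suffices h : M₁.HasFixedPoint (Ψ₁₂ ≪≫ Ψ₂₃ ≪≫ Ψ₃₁) → evalCube D T = 0 from
    ⟨h, fun hne hfix => hne (h hfix)⟩
  rintro ⟨p, hp, hfix⟩
  have hp₂ : M₂.IsGeometricPoint (p ≫ Ψ₁₂.hom) := by
    rw [NonsingularModel.IsGeometricPoint, Category.assoc, h₁₂.isOver, hp]
  have hp₃ : M₃.IsGeometricPoint ((p ≫ Ψ₁₂.hom) ≫ Ψ₂₃.hom) := by
    rw [NonsingularModel.IsGeometricPoint, Category.assoc, h₂₃.isOver, hp₂]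
  have hfix' : ((p ≫ Ψ₁₂.hom) ≫ Ψ₂₃.hom) ≫ Ψ₃₁.hom = p := by
    simpa only [Iso.trans_hom, Category.assoc] using hfix
  -- The vectors `x`, `y`, `z` are read off in charts; each has a coordinate equal to `1` and so is
  -- nonzero.
  obtain ⟨i, e, he⟩ := P3.exists_chart_eval (p ≫ M₁.π ≫ surfaceι _)
  obtain ⟨j, e', he'⟩ := P3.exists_chart_eval ((p ≫ Ψ₁₂.hom) ≫ M₂.π ≫ surfaceι _)
  obtain ⟨k, e'', he''⟩ :=
    P3.exists_chart_eval (((p ≫ Ψ₁₂.hom) ≫ Ψ₂₃.hom) ≫ M₃.π ≫ surfaceι _)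
  have hxy := IsLift.form_eq_zero rfl h₁ h₁₂ hp he he'
  rw [T.psi₁₂_rotate] at h₂₃
  rw [T.psi₁₂_rotate_rotate] at h₃₁
  have hyz := IsLift.form_eq_zero T.quartic₁_rotate h₂ h₂₃ hp₂ he' he''
  -- The fixed point closes the cycle: the image of the third point is `p` itself, so the same `x`
  -- occurs in the first and last equations.
  have hzx := IsLift.form_eq_zero T.quartic₁_rotate_rotate h₃ h₃₁ hp₃ he'' (by rw [hfix']; exact he)
  simp only [Cube.form_geom_rotate] at hyz hzx
  exact evalCube_eq_zero_of_geom ((hD.1 T.geom).mpr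
    ⟨_, _, _, P3.chart_eval_ne_zero e, P3.chart_eval_ne_zero e', P3.chart_eval_ne_zero e'', hxy, hzx, hyz⟩)
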